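/- Let $d\ge 1$ be an integer and let $c,C>0$. Call an infinite set $A\subset\mathbb R^d$ well-distributed with constants $c,C$ if $\|a-a'\|\ge c$ for all distinct $a,a'\in A$ and every closed axis-parallel cube of side length $C$ contains a point of $A$; here $\|\cdot\|$ is the Euclidean norm. For $q>0$ let $A_q=A\cap B(0,q)$, where $B(0,q)$ is the open Euclidean ball of radius $q$ centered at the origin, and for $E\subset\mathbb R^d$ let $\Delta(E)=\{\|x-y\|:x,y\in E\}$. Then there is a constant $\kappa>0$, depending only on $d$, $c$ and $C$, such that for every set $A\subset\mathbb R^d$ that is well-distributed with constants $c,C$ and every $q>0$, the set $A_q$ is finite and $$|\Delta(A_q)|\;\ge\;\kappa\,|A_q|^{\frac2d-\frac1{d^2}},$$ where $|\cdot|$ denotes cardinality. -/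

import Mathlib

/-- `IsWellDistributed c C A`: the infinite point set `A` in Euclidean space of dimension `d` is
well-distributed (a Delone set) with constants `c` and `C`. -/
structure IsWellDistributed {d : ℕ} (c C : ℝ) (A : Set (EuclideanSpace ℝ (Fin d))) : Prop where
  infinite : A.Infinite
  /-- Distinct points of `A` are at Euclidean distance at least `c`. -/
  separated : ∀ a ∈ A, ∀ b ∈ A, a ≠ b → c ≤ ‖a - b‖
  /-- Every closed coordinate cube of side length `C` contains a point of `A`. -/
  meets_cubes : ∀ x : EuclideanSpace ℝ (Fin d), ∃ a ∈ A, ∀ i, x i ≤ a i ∧ a i ≤ x i + C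

/-- The truncation of `A` to the Euclidean ball of radius `q` centered at the origin. -/
def truncation {d : ℕ} (A : Set (EuclideanSpace ℝ (Fin d))) (q : ℝ) :
    Set (EuclideanSpace ℝ (Fin d)) :=
  A ∩ Metric.ball 0 q

/-- The set of Euclidean distances determined by `E`. -/
def distanceSet {d : ℕ} (E : Set (EuclideanSpace ℝ (Fin d))) : Set ℝ :=
  {r | ∃ x ∈ E, ∃ y ∈ E, r = ‖x - y‖}

/-!
Write `n` for the dimension, so that `A_q` has about `q ^ n` points. Round the points of `A_q` to a
maximal `s`-separated subset, and for a pin `p` in `A_q` send `x` to its rounding paired with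
`dist x p`. A sphere meets only `O((q / s) ^ (n - 1))` cells of the rounding, so up to collisions
the number of distances to `p` is at least `q ^ n / (q / s) ^ (n - 1)`. A collision at `p` is a
pair of distinct points in a common cell both equidistant from `p`. There are `O(q ^ n s ^ n)`
pairs in a common cell, and the perpendicular bisector of each contains `O(q ^ (n - 1))` pins, so
an average pin sees `O(s ^ n q ^ (n - 1))` collisions. For `s ^ n = η q` with `η` small this is at
most half of `|A_q|`, and some pin sees at least a constant times `q ^ (2 - 1 / n)` distances.
-/

open Filter Metric MeasureTheory Module Set
open Delone (DeloneSet)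

section Packing

variable {E : Type*} [NormedAddCommGroup E] [NormedSpace ℝ E] [FiniteDimensional ℝ E]
  {S : Finset E} {p : E} {δ : ℝ}

theorem measureReal_ball_pos [MeasurableSpace E] [BorelSpace E] (μ : Measure E)
    [μ.IsAddHaarMeasure] (x : E) {r : ℝ} (hr : 0 < r) : 0 < μ.real (ball x r) :=
  ENNReal.toReal_pos (measure_ball_pos μ x hr).ne' measure_ball_lt_top.ne

theorem card_mul_pow_mul_measureReal_ball_le [MeasurableSpace E] [BorelSpace E] (μ : Measure E)
    [μ.IsAddHaarMeasure] (hδ : 0 < δ) (hS : (S : Set E).Pairwise (δ ≤ dist · ·)) {T : Set E}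
    (hT : ∀ x ∈ S, ball x (δ / 2) ⊆ T) (hT_fin : μ T ≠ ⊤) :
    S.card * (δ / 2) ^ finrank ℝ E * μ.real (ball 0 1) ≤ μ.real T := by
  have hdisj : (S : Set E).PairwiseDisjoint fun x => ball x (δ / 2) := fun x hx y hy hxy =>
    ball_disjoint_ball (by simpa using hS hx hy hxy)
  have hball (x : E) :
      μ.real (ball x (δ / 2)) = (δ / 2) ^ finrank ℝ E * μ.real (ball 0 1) := by
    rw [measureReal_def, Measure.addHaar_ball_of_pos μ x (half_pos hδ), ENNReal.toReal_mul,
      ENNReal.toReal_ofReal (by positivity), measureReal_def]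
  calc S.card * (δ / 2) ^ finrank ℝ E * μ.real (ball 0 1)
      = ∑ x ∈ S, μ.real (ball x (δ / 2)) := by
        simp only [hball, Finset.sum_const, nsmul_eq_mul, mul_assoc]
    _ = μ.real (⋃ x ∈ S, ball x (δ / 2)) :=
        (measureReal_biUnion_finset hdisj fun _ _ => measurableSet_ball).symm
    _ ≤ μ.real T := measureReal_mono (iUnion₂_subset hT) hT_fin

theorem card_le_of_separated (hδ : 0 < δ) (hS : (S : Set E).Pairwise (δ ≤ dist · ·)) {R : ℝ}
    (hR : 0 ≤ R) (hp : ∀ x ∈ S, dist x p ≤ R) :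
    (S.card : ℝ) ≤ (2 * R / δ + 1) ^ finrank ℝ E := by
  borelize E
  let μ : Measure E := Measure.addHaar
  have hvol := card_mul_pow_mul_measureReal_ball_le μ hδ hS
    (T := closedBall p (R + δ / 2))
    (fun x hx => ball_subset_closedBall.trans (closedBall_subset_closedBall' (by
      linarith [hp x hx]))) measure_closedBall_lt_top.ne
  rw [Measure.addHaar_real_closedBall μ p (by positivity),
    mul_le_mul_iff_left₀ (measureReal_ball_pos μ 0 one_pos)] at hvol
  calc (S.card : ℝ) ≤ (R + δ / 2) ^ finrank ℝ E / (δ / 2) ^ finrank ℝ E :=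
        (le_div_iff₀ (by positivity)).2 hvol
    _ = (2 * R / δ + 1) ^ finrank ℝ E := by
        rw [← div_pow]
        congr 1
        field_simp

theorem card_mul_pow_le_of_separated_of_near_sphere [Nontrivial E] (hδ : 0 < δ)
    (hS : (S : Set E).Pairwise (δ ≤ dist · ·)) {r w : ℝ} (hr : 0 ≤ r) (hw : 0 ≤ w)
    (hp : ∀ x ∈ S, |dist x p - r| ≤ w) :
    S.card * (δ / 2) ^ finrank ℝ E ≤
      (2 * w + δ) * finrank ℝ E * (r + w + δ / 2) ^ (finrank ℝ E - 1) := by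
  borelize E
  let μ : Measure E := Measure.addHaar
  set R₁ := max (r - w - δ / 2) 0
  set R₂ := r + w + δ / 2 with hR₂_def
  have hR₁ : 0 ≤ R₁ := le_max_right _ _
  have hR₂ : 0 ≤ R₂ := by positivity
  have hR : R₁ ≤ R₂ := max_le (by linarith) hR₂
  have hwidth : R₂ - R₁ ≤ 2 * w + δ := by linarith [le_max_left (r - w - δ / 2) 0]
  have hshell : ∀ x ∈ S, ball x (δ / 2) ⊆ closedBall p R₂ \ ball p R₁ := by
    intro x hx y hy
    have hx' := abs_le.1 (hp x hx)
    rw [mem_ball] at hy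
    refine ⟨mem_closedBall.2 ?_, fun hy' => not_lt.2 (max_le ?_ dist_nonneg) (mem_ball.1 hy')⟩
    · linarith [dist_triangle y x p]
    · linarith [dist_triangle_left x p y]
  have hvol := card_mul_pow_mul_measureReal_ball_le μ hδ hS hshell
    (measure_ne_top_of_subset sdiff_subset measure_closedBall_lt_top.ne)
  rw [measureReal_sdiff (ball_subset_closedBall.trans (closedBall_subset_closedBall hR))
      measurableSet_ball measure_closedBall_lt_top.ne,
    ← Measure.addHaar_real_closedBall_eq_addHaar_real_ball μ p R₁,
    Measure.addHaar_real_closedBall μ p hR₂, Measure.addHaar_real_closedBall μ p hR₁, ← sub_mul,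
    mul_le_mul_iff_left₀ (measureReal_ball_pos μ 0 one_pos)] at hvol
  calc S.card * (δ / 2) ^ finrank ℝ E ≤ R₂ ^ finrank ℝ E - R₁ ^ finrank ℝ E := hvol
    _ ≤ (R₂ - R₁) * finrank ℝ E * R₂ ^ (finrank ℝ E - 1) := by
        have := abs_pow_sub_pow_le R₂ R₁ (finrank ℝ E)
        rw [abs_of_nonneg hR₁, abs_of_nonneg hR₂, max_eq_left hR,
          abs_of_nonneg (sub_nonneg.2 hR)] at this
        exact (le_abs_self _).trans this
    _ ≤ (2 * w + δ) * finrank ℝ E * R₂ ^ (finrank ℝ E - 1) := by gcongr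

theorem div_pow_finrank_le_card_of_cover {D R : ℝ} (hD : 0 < D) (hR : 0 ≤ R)
    (hS : closedBall p R ⊆ ⋃ x ∈ S, closedBall x D) :
    (R / D) ^ finrank ℝ E ≤ S.card := by
  borelize E
  let μ : Measure E := Measure.addHaar
  rw [div_pow, div_le_iff₀ (by positivity)]
  refine le_of_mul_le_mul_right ?_ (measureReal_ball_pos μ (0 : E) one_pos)
  calc R ^ finrank ℝ E * μ.real (ball 0 1)
      = μ.real (closedBall p R) := (Measure.addHaar_real_closedBall μ p hR).symm
    _ ≤ μ.real (⋃ x ∈ S, closedBall x D) := measureReal_mono hS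
        (measure_biUnion_lt_top S.finite_toSet fun _ _ => measure_closedBall_lt_top).ne
    _ ≤ ∑ x ∈ S, μ.real (closedBall x D) := measureReal_biUnion_finset_le S _
    _ = S.card * D ^ finrank ℝ E * μ.real (ball 0 1) := by
        simp only [Measure.addHaar_real_closedBall μ _ hD.le, Finset.sum_const, nsmul_eq_mul,
          mul_assoc]

end Packing

theorem card_le_of_separated_of_subset_affineSubspace {E : Type*} [NormedAddCommGroup E]
    [NormedSpace ℝ E] [FiniteDimensional ℝ E] (Q : AffineSubspace ℝ E) {S : Finset E}
    (hSQ : (S : Set E) ⊆ Q) {δ R : ℝ} (hδ : 0 < δ) (hR : 0 ≤ R)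
    (hS : (S : Set E).Pairwise (δ ≤ dist · ·)) {p : E} (hp : ∀ x ∈ S, dist x p ≤ R) :
    (S.card : ℝ) ≤ (4 * R / δ + 1) ^ finrank ℝ Q.direction := by
  classical
  rcases S.eq_empty_or_nonempty with rfl | ⟨x₀, hx₀⟩
  · simp only [Finset.card_empty, Nat.cast_zero]
    positivity
  let f : Q.direction → E := fun v => v + x₀
  have hf : Isometry f := Isometry.of_dist_eq fun v w => dist_add_right _ _ _
  let S' := S.preimage f hf.injective.injOn
  have hS' : S'.card = S.card := by
    rw [Finset.card_preimage, Finset.filter_true_of_mem]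
    intro x hx
    exact ⟨⟨x - x₀, AffineSubspace.vsub_mem_direction (hSQ hx) (hSQ hx₀)⟩, sub_add_cancel _ _⟩
  have hsep : (S' : Set Q.direction).Pairwise (δ ≤ dist · ·) := fun v hv w hw hvw => by
    change δ ≤ dist v w
    rw [← hf.dist_eq]
    exact hS (Finset.mem_preimage.1 hv) (Finset.mem_preimage.1 hw) (hf.injective.ne hvw)
  have hdist : ∀ v ∈ S', dist v 0 ≤ 2 * R := fun v hv => by
    rw [← hf.dist_eq, show f 0 = x₀ by simp [f]]
    linarith [dist_triangle_right (f v) x₀ p, hp _ (Finset.mem_preimage.1 hv), hp _ hx₀]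
  calc (S.card : ℝ) = S'.card := by rw [hS']
    _ ≤ (2 * (2 * R) / δ + 1) ^ finrank ℝ Q.direction :=
        card_le_of_separated hδ hsep (by positivity) hdist
    _ = (4 * R / δ + 1) ^ finrank ℝ Q.direction := by ring

theorem finrank_direction_perpBisector {E : Type*} [NormedAddCommGroup E]
    [InnerProductSpace ℝ E] [FiniteDimensional ℝ E] {x y : E} (hxy : x ≠ y) :
    finrank ℝ (AffineSubspace.perpBisector x y).direction = finrank ℝ E - 1 := by
  rw [AffineSubspace.direction_perpBisector]
  have := Submodule.finrank_add_finrank_orthogonal (ℝ ∙ (y -ᵥ x))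
  rw [finrank_span_singleton (vsub_ne_zero.2 hxy.symm)] at this
  omega

theorem exists_separated_rounding {X : Type*} [PseudoMetricSpace X] {P : Set X} (hP : P.Finite)
    {s : ℝ} (hs : 0 ≤ s) :
    ∃ g : X → X, (∀ x ∈ P, dist x (g x) ≤ s) ∧ (g '' P).Pairwise (s ≤ dist · ·) := by
  lift s to NNReal using hs
  let N := maximalSeparatedSet s P
  have hN_sep : IsSeparated s N := isSeparated_maximalSeparatedSet
  have hN_cover : IsCover s P N := isCover_maximalSeparatedSet
    (ne_top_of_le_ne_top hP.encard_lt_top.ne (packingNumber_le_encard_self P))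
  have hnear : ∀ x ∈ P, ∃ y ∈ N, dist x y ≤ s := fun x hx => by
    simpa using hN_cover.subset_iUnion_closedBall hx
  choose! g hgN hg using hnear
  refine ⟨g, hg, Set.Pairwise.mono (image_subset_iff.2 hgN) fun y hy z hz hyz => ?_⟩
  have := (hN_sep hy hz hyz).le
  rw [edist_nndist, ENNReal.coe_le_coe] at this
  exact_mod_cast this

theorem card_le_mul_card_of_maps_to {α β : Type*} [DecidableEq β] {f : α → β} {s : Finset α}
    {t : Finset β} (hf : ∀ a ∈ s, f a ∈ t) {K : ℝ}
    (hK : ∀ b ∈ t, ((s.filter (f · = b)).card : ℝ) ≤ K) : (s.card : ℝ) ≤ t.card * K := by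
  rw [Finset.card_eq_sum_card_fiberwise hf, Nat.cast_sum, ← nsmul_eq_mul]
  exact Finset.sum_le_card_nsmul _ _ _ hK

theorem card_le_card_image_add_card_collisions {α β : Type*} [DecidableEq β]
    (P : Finset α) (f : α → β) :
    P.card ≤ (P.image f).card + (P.offDiag.filter fun z => f z.1 = f z.2).card := by
  classical
  obtain ⟨T, hTP, hT_inj, hT_img⟩ := Finset.exists_subset_injOn_image_eq_of_surjOn (P : Set α)
    (P.image f) (by simpa using surjOn_image f P)
  have hcollide : P \ T ⊆ (P.offDiag.filter fun z => f z.1 = f z.2).image Prod.fst := by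
    intro x hx
    obtain ⟨hxP, hxT⟩ := Finset.mem_sdiff.1 hx
    obtain ⟨y, hyT, hyx⟩ := Finset.mem_image.1 (hT_img ▸ Finset.mem_image_of_mem f hxP)
    have hxy : x ≠ y := fun h => hxT (h ▸ hyT)
    exact Finset.mem_image.2 ⟨(x, y), by
      simp [hxP, Finset.mem_coe.1 (hTP hyT), hxy, hyx.symm], rfl⟩
  calc P.card ≤ T.card + (P \ T).card := by
        rw [add_comm]; exact Finset.card_le_card_sdiff_add_card
    _ ≤ (P.image f).card + (P.offDiag.filter fun z => f z.1 = f z.2).card := by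
        gcongr
        · rw [← hT_img, Finset.card_image_of_injOn hT_inj]
        · exact (Finset.card_le_card hcollide).trans Finset.card_image_le

section Incidence

variable {E : Type*} [NormedAddCommGroup E] [InnerProductSpace ℝ E] [FiniteDimensional ℝ E]
  {P : Finset E} {g : E → E} {δ s q : ℝ}

theorem card_image_sphere_le [DecidableEq E] [Nontrivial E] (hs : 0 < s) (hsq : s ≤ q)
    (hg : ∀ x ∈ P, dist x (g x) ≤ s) (hg_sep : (g '' P).Pairwise (s ≤ dist · ·)) {p : E} {r : ℝ}
    (hr : 0 ≤ r) (hrq : r ≤ 2 * q) :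
    (((P.filter (dist · p = r)).image g).card : ℝ) ≤
      6 * finrank ℝ E * (8 * q / s) ^ (finrank ℝ E - 1) := by
  have : 0 < q := hs.trans_le hsq
  have hnear : ∀ y ∈ (P.filter (dist · p = r)).image g, |dist y p - r| ≤ s := by
    simp only [Finset.forall_mem_image, Finset.mem_filter]
    rintro x ⟨hx, rfl⟩
    exact (abs_dist_sub_le (g x) x p).trans (dist_comm (g x) x ▸ hg x hx)
  have hcard := card_mul_pow_le_of_separated_of_near_sphere hs
    (hg_sep.mono (by grind)) hr hs.le hnear
  have hpow : (s / 2) ^ finrank ℝ E = s / 2 * (s / 2) ^ (finrank ℝ E - 1) :=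
    (mul_pow_sub_one finrank_pos.ne' _).symm
  rw [← le_div_iff₀ (by positivity), hpow] at hcard
  calc (((P.filter (dist · p = r)).image g).card : ℝ)
      ≤ (2 * s + s) * finrank ℝ E * (r + s + s / 2) ^ (finrank ℝ E - 1) /
          (s / 2 * (s / 2) ^ (finrank ℝ E - 1)) := hcard
    _ ≤ (2 * s + s) * finrank ℝ E * (4 * q) ^ (finrank ℝ E - 1) /
          (s / 2 * (s / 2) ^ (finrank ℝ E - 1)) := by
        gcongr
        linarith
    _ = 6 * finrank ℝ E * (8 * q / s) ^ (finrank ℝ E - 1) := by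
        rw [show 8 * q / s = 4 * q / (s / 2) by ring, mul_div_mul_comm, ← div_pow]
        congr 1
        field_simp
        ring

theorem card_image_prod_dist_le [DecidableEq E] [Nontrivial E] (hs : 0 < s) (hsq : s ≤ q)
    (hg : ∀ x ∈ P, dist x (g x) ≤ s) (hg_sep : (g '' P).Pairwise (s ≤ dist · ·)) {p : E}
    (hp : ∀ x ∈ P, dist x p ≤ 2 * q) :
    ((P.image fun x => (g x, dist x p)).card : ℝ) ≤
      (P.image (dist · p)).card * (6 * finrank ℝ E * (8 * q / s) ^ (finrank ℝ E - 1)) := by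
  refine card_le_mul_card_of_maps_to (f := Prod.snd) (by grind) fun r hr => ?_
  obtain ⟨x₀, hx₀, rfl⟩ := Finset.mem_image.1 hr
  refine le_trans ?_ (card_image_sphere_le hs hsq hg hg_sep (p := p) dist_nonneg (hp x₀ hx₀))
  exact_mod_cast Finset.card_le_card_of_injOn Prod.fst (by grind [MapsTo]) (by grind [InjOn])

theorem card_pairs_same_image_le [DecidableEq E] (hδ : 0 < δ) (hδs : δ ≤ s)
    (hP : (P : Set E).Pairwise (δ ≤ dist · ·)) (hg : ∀ x ∈ P, dist x (g x) ≤ s) :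
    ((P.offDiag.filter fun z => g z.1 = g z.2).card : ℝ) ≤
      P.card * (3 * s / δ) ^ finrank ℝ E := by
  refine card_le_mul_card_of_maps_to (f := Prod.fst) (by grind) fun x _ => ?_
  have hfibre : ((P.filter (g · = g x)).card : ℝ) ≤ (2 * s / δ + 1) ^ finrank ℝ E :=
    card_le_of_separated hδ (hP.mono (by grind)) (by linarith) (p := g x) (by grind)
  calc _ ≤ ((P.filter (g · = g x)).card : ℝ) := by
        exact_mod_cast Finset.card_le_card_of_injOn Prod.snd (by grind [MapsTo])
          (by grind [InjOn])
    _ ≤ (2 * s / δ + 1) ^ finrank ℝ E := hfibre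
    _ ≤ (3 * s / δ) ^ finrank ℝ E := by
        have : 1 ≤ s / δ := (one_le_div hδ).2 hδs
        have hs : 0 < s := hδ.trans_le hδs
        gcongr
        linear_combination this

theorem card_equidistant_le (hδ : 0 < δ) (hδq : δ ≤ q) (hP : (P : Set E).Pairwise (δ ≤ dist · ·))
    {p₀ : E} (hPq : ∀ x ∈ P, dist x p₀ ≤ q) {x y : E} (hxy : x ≠ y) :
    ((P.filter fun p => dist x p = dist y p).card : ℝ) ≤ (5 * q / δ) ^ (finrank ℝ E - 1) := by
  have hsub : ((P.filter fun p => dist x p = dist y p : Finset E) : Set E) ⊆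
      AffineSubspace.perpBisector x y := fun p hp => by
    rw [SetLike.mem_coe, AffineSubspace.mem_perpBisector_iff_dist_eq, dist_comm p, dist_comm p]
    exact (Finset.mem_filter.1 hp).2
  have hcard := card_le_of_separated_of_subset_affineSubspace _ hsub hδ (by linarith)
    (hP.mono (by grind)) (p := p₀) (R := q) (by grind)
  rw [finrank_direction_perpBisector hxy] at hcard
  have : 1 ≤ q / δ := (one_le_div hδ).2 hδq
  have hq : 0 < q := hδ.trans_le hδq
  refine hcard.trans ?_
  gcongr
  linear_combination this

theorem sum_card_collisions_le [DecidableEq E] (hδ : 0 < δ) (hδs : δ ≤ s) (hδq : δ ≤ q)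
    (hP : (P : Set E).Pairwise (δ ≤ dist · ·)) {p₀ : E} (hPq : ∀ x ∈ P, dist x p₀ ≤ q)
    (hg : ∀ x ∈ P, dist x (g x) ≤ s) :
    ∑ p ∈ P, ((P.offDiag.filter fun z => (g z.1, dist z.1 p) = (g z.2, dist z.2 p)).card : ℝ) ≤
      P.card * ((3 * s / δ) ^ finrank ℝ E * (5 * q / δ) ^ (finrank ℝ E - 1)) := by
  let N := P.offDiag.filter fun z => g z.1 = g z.2
  calc ∑ p ∈ P, ((P.offDiag.filter fun z => (g z.1, dist z.1 p) = (g z.2, dist z.2 p)).card : ℝ)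
      = ∑ p ∈ P, ((N.filter fun z => dist z.1 p = dist z.2 p).card : ℝ) := by
        simp only [N, Finset.filter_filter, Prod.mk.injEq]
    _ = ∑ z ∈ N, ((P.filter fun p => dist z.1 p = dist z.2 p).card : ℝ) := by
        exact_mod_cast Finset.sum_card_bipartiteAbove_eq_sum_card_bipartiteBelow
          fun p (z : E × E) => dist z.1 p = dist z.2 p
    _ ≤ N.card * (5 * q / δ) ^ (finrank ℝ E - 1) := by
        rw [← nsmul_eq_mul]
        exact Finset.sum_le_card_nsmul _ _ _ fun z hz =>
          card_equidistant_le hδ hδq hP hPq (by grind)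
    _ ≤ P.card * (3 * s / δ) ^ finrank ℝ E * (5 * q / δ) ^ (finrank ℝ E - 1) := by
        have hq : 0 < q := hδ.trans_le hδq
        gcongr
        exact card_pairs_same_image_le hδ hδs hP hg
    _ = _ := mul_assoc _ _ _

theorem exists_pin_card_le [Nontrivial E] (hδ : 0 < δ) (hδs : δ ≤ s) (hsq : s ≤ q)
    (hP : (P : Set E).Pairwise (δ ≤ dist · ·)) {p₀ : E} (hPq : ∀ x ∈ P, dist x p₀ ≤ q)
    (hP_ne : P.Nonempty) :
    ∃ p ∈ P, (P.card : ℝ) ≤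
      (P.image (dist · p)).card * (6 * finrank ℝ E * (8 * q / s) ^ (finrank ℝ E - 1)) +
        (3 * s / δ) ^ finrank ℝ E * (5 * q / δ) ^ (finrank ℝ E - 1) := by
  classical
  have hs : 0 < s := hδ.trans_le hδs
  obtain ⟨g, hg, hg_sep⟩ := exists_separated_rounding P.finite_toSet hs.le
  have hsum := sum_card_collisions_le hδ hδs (hδs.trans hsq) hP hPq hg
  rw [← nsmul_eq_mul, ← Finset.sum_const] at hsum
  obtain ⟨p, hp, hcollisions⟩ := Finset.exists_le_of_sum_le hP_ne hsum
  have hdiam : ∀ x ∈ P, dist x p ≤ 2 * q := fun x hx => by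
    linarith [dist_triangle_right x p p₀, hPq x hx, hPq p hp]
  refine ⟨p, hp, ?_⟩
  calc (P.card : ℝ)
      ≤ (P.image fun x => (g x, dist x p)).card +
          (P.offDiag.filter fun z => (g z.1, dist z.1 p) = (g z.2, dist z.2 p)).card := by
        exact_mod_cast card_le_card_image_add_card_collisions P fun x => (g x, dist x p)
    _ ≤ _ := add_le_add (card_image_prod_dist_le hs hsq hg hg_sep hdiam) hcollisions

end Incidence

theorem exists_scale_optimization {n : ℕ} (hn : n ≠ 0) {a b M : ℝ} (ha : 0 < a) (hb : 0 < b)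
    (hM : 0 < M) (δ : ℝ) :
    ∃ κ > 0, ∀ᶠ q : ℝ in atTop, ∃ s, δ ≤ s ∧ s ≤ q ∧ ∀ t : ℝ,
      a * q ^ n ≤ t * (M * (q / s) ^ (n - 1)) + b * (s ^ n * q ^ (n - 1)) →
        κ * q ^ (2 - 1 / n : ℝ) ≤ t := by
  -- The term with `b` is half of the left-hand side for `s ^ n = η * q`, where `η ≈ a / (2 * b)`.
  obtain ⟨η, hη, hη1, hηb⟩ : ∃ η > 0, η ≤ 1 ∧ b * η ≤ a / 2 :=
    ⟨min 1 (a / (2 * b)), by positivity, min_le_left _ _, by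
      calc b * min 1 (a / (2 * b)) ≤ b * (a / (2 * b)) := by gcongr; exact min_le_right _ _
        _ = a / 2 := by field_simp⟩
  have hlarge : Tendsto (fun q : ℝ => (η * q) ^ (1 / n : ℝ)) atTop atTop :=
    (tendsto_rpow_atTop (by positivity)).comp (tendsto_id.const_mul_atTop hη)
  refine ⟨a / (2 * M) * η ^ (1 - 1 / n : ℝ), by positivity, ?_⟩
  filter_upwards [hlarge.eventually_ge_atTop δ, eventually_ge_atTop 1] with q hδ hq
  have hq0 : 0 < q := one_pos.trans_le hq
  set s := (η * q) ^ (1 / n : ℝ) with hs_def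
  have hs : 0 < s := by positivity
  have hsn : s ^ n = η * q := by
    rw [hs_def, one_div, Real.rpow_inv_natCast_pow (by positivity) hn]
  have hsn' : s ^ (n - 1) = (η * q) ^ (1 - 1 / n : ℝ) := by
    rw [pow_sub₀ _ hs.ne' (Nat.one_le_iff_ne_zero.2 hn), hsn, pow_one,
      ← div_eq_mul_inv, hs_def, Real.rpow_sub (by positivity), Real.rpow_one]
  have hqn : q ^ n = q * q ^ (n - 1) := (mul_pow_sub_one hn q).symm
  refine ⟨s, hδ, ?_, fun t ht => ?_⟩
  · refine le_of_pow_le_pow_left₀ hn hq0.le ?_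
    calc s ^ n = η * q := hsn
      _ ≤ 1 * q := by gcongr
      _ ≤ q ^ n := by simpa using le_self_pow₀ hq hn
  have hmain : a / 2 * q ^ n ≤ t * (M * (q / s) ^ (n - 1)) := by
    have : b * (s ^ n * q ^ (n - 1)) ≤ a / 2 * q ^ n := by
      calc b * (s ^ n * q ^ (n - 1)) = b * η * q ^ n := by rw [hsn, hqn]; ring
        _ ≤ a / 2 * q ^ n := by gcongr
    linarith
  calc a / (2 * M) * η ^ (1 - 1 / n : ℝ) * q ^ (2 - 1 / n : ℝ)
      = a / (2 * M) * q * s ^ (n - 1) := by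
        rw [hsn', Real.mul_rpow hη.le hq0.le, show (2 - 1 / n : ℝ) = 1 + (1 - 1 / n) by ring,
          Real.rpow_add hq0, Real.rpow_one]
        ring
    _ = a / 2 * q ^ n / (M * (q / s) ^ (n - 1)) := by
        rw [hqn, div_pow]
        field_simp
    _ ≤ t := (div_le_iff₀ (by positivity)).2 hmain

theorem two_div_sub_one_div_sq_pos {n : ℕ} (hn : 0 < n) : 0 < (2 / n - 1 / n ^ 2 : ℝ) := by
  have : (1 / n : ℝ) ≤ 1 := by simpa only [one_div] using n.cast_inv_le_one
  rw [show (2 / n - 1 / n ^ 2 : ℝ) = (2 - 1 / n) / n by ring]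
  exact div_pos (by linarith) (Nat.cast_pos.2 hn)

theorem finite_inter_of_pairwise_le_dist {X : Type*} [MetricSpace X] [ProperSpace X] {A B : Set X}
    {δ : ℝ} (hδ : 0 < δ) (hA : A.Pairwise (δ ≤ dist · ·)) (hB : Bornology.IsBounded B) :
    (A ∩ B).Finite := by
  have hdisc : DiscreteTopology A := .of_forall_le_dist hδ fun x y hxy =>
    hA x.2 y.2 (Subtype.coe_ne_coe.2 hxy)
  rw [inter_comm]
  exact finite_isBounded_inter_isClosed ⟨hdisc⟩ hB (isClosed_of_pairwise_le_dist hδ hA)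

theorem pairwise_le_dist_of_le_packingRadius {X : Type*} [MetricSpace X] {A : DeloneSet X} {r : ℝ}
    (hr : r ≤ A.packingRadius) : (A : Set X).Pairwise (r ≤ dist · ·) :=
  fun _ hx _ hy hxy => hr.trans (A.packingRadius_lt_dist_of_mem_ne hx hy hxy).le

section DeloneSet

variable {E : Type*} [NormedAddCommGroup E]

theorem div_pow_finrank_le_card_of_coveringRadius_le [NormedSpace ℝ E] [FiniteDimensional ℝ E]
    {A : DeloneSet E} {P : Finset E} {p : E} {q R : ℝ} (hP : (P : Set E) = ↑A ∩ ball p q)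
    (hA : A.coveringRadius ≤ R) (hR : 0 < R) (hRq : R < q / 2) :
    (q / 2 / R) ^ finrank ℝ E ≤ P.card := by
  refine div_pow_finrank_le_card_of_cover hR (p := p) (by linarith) fun y hy => ?_
  obtain ⟨a, ha, hya⟩ := A.exists_dist_le_coveringRadius y
  have haP : a ∈ P := by
    rw [← Finset.mem_coe, hP]
    refine ⟨ha, mem_ball.2 ?_⟩
    linarith [dist_triangle_left a p y, mem_closedBall.1 hy]
  exact mem_biUnion haP (mem_closedBall.2 (hya.trans hA))

theorem ncard_rpow_le_of_le_packingRadius [NormedSpace ℝ E] [FiniteDimensional ℝ E] [Nontrivial E]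
    {A : DeloneSet E} {p : E} {q Q r : ℝ} (hr : 0 < r) (hA : r ≤ A.packingRadius) (hqQ : q ≤ Q)
    (hrQ : r ≤ Q) :
    ((↑A ∩ ball p q).ncard : ℝ) ^ (2 / finrank ℝ E - 1 / finrank ℝ E ^ 2 : ℝ) ≤
      (3 * Q / r) ^ (2 - 1 / finrank ℝ E : ℝ) := by
  have hsep := pairwise_le_dist_of_le_packingRadius hA
  have hfin := finite_inter_of_pairwise_le_dist hr hsep (isBounded_ball (x := p) (r := q))
  have hQ : 0 < Q := hr.trans_le hrQ
  have hcard : ((↑A ∩ ball p q).ncard : ℝ) ≤ (3 * Q / r) ^ finrank ℝ E := by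
    rw [ncard_eq_toFinset_card _ hfin]
    calc (hfin.toFinset.card : ℝ) ≤ (2 * Q / r + 1) ^ finrank ℝ E :=
          card_le_of_separated hr (hsep.mono (by simp)) hQ.le (p := p) fun x hx =>
            (mem_ball.1 (hfin.mem_toFinset.1 hx).2).le.trans hqQ
      _ ≤ (3 * Q / r) ^ finrank ℝ E := by
          have : 1 ≤ Q / r := (one_le_div hr).2 hrQ
          gcongr
          linear_combination this
  have hn : (finrank ℝ E : ℝ) ≠ 0 := by exact_mod_cast finrank_pos.ne'
  have hexp := (two_div_sub_one_div_sq_pos (finrank_pos (R := ℝ) (M := E))).le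
  calc ((↑A ∩ ball p q).ncard : ℝ) ^ (2 / finrank ℝ E - 1 / finrank ℝ E ^ 2 : ℝ)
      ≤ ((3 * Q / r) ^ finrank ℝ E) ^ (2 / finrank ℝ E - 1 / finrank ℝ E ^ 2 : ℝ) := by gcongr
    _ = (3 * Q / r) ^ (2 - 1 / finrank ℝ E : ℝ) := by
        rw [← Real.rpow_natCast, ← Real.rpow_mul (by positivity)]
        congr 1
        field_simp

theorem exists_mul_rpow_le_pinned_distances (E : Type*) [NormedAddCommGroup E]
    [InnerProductSpace ℝ E] [FiniteDimensional ℝ E] [Nontrivial E] {r R : ℝ} (hr : 0 < r)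
    (hR : 0 < R) :
    ∃ κ > 0, ∀ᶠ q : ℝ in atTop, ∀ A : DeloneSet E, r ≤ A.packingRadius → A.coveringRadius ≤ R →
      ∀ p, ∃ x ∈ (A : Set E) ∩ ball p q,
        κ * q ^ (2 - 1 / finrank ℝ E : ℝ) ≤ ((dist · x) '' (A ∩ ball p q)).ncard := by
  set n := finrank ℝ E
  have hn : 0 < n := finrank_pos
  obtain ⟨κ, hκ, hlarge⟩ := exists_scale_optimization hn.ne' (a := (1 / (2 * R)) ^ n)
    (b := (3 / r) ^ n * (5 / r) ^ (n - 1)) (M := 6 * n * 8 ^ (n - 1)) (by positivity)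
    (by positivity) (by positivity) r
  refine ⟨κ, hκ, ?_⟩
  filter_upwards [hlarge, eventually_gt_atTop (2 * R)] with q ⟨s, hrs, hsq, hs⟩ hRq A hAr hAR p
  have hsep := pairwise_le_dist_of_le_packingRadius hAr
  obtain ⟨P, hP⟩ := (finite_inter_of_pairwise_le_dist hr hsep
    (isBounded_ball (x := p) (r := q))).exists_finset_coe
  have hmem {x : E} (hx : x ∈ P) : x ∈ ↑A ∩ ball p q := hP ▸ hx
  have hcard : (q / 2 / R) ^ n ≤ P.card :=
    div_pow_finrank_le_card_of_coveringRadius_le hP hAR hR (by linarith)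
  have hP_ne : P.Nonempty := by
    rw [← Finset.card_pos, ← Nat.cast_pos (α := ℝ)]
    have : 0 < q := by linarith
    exact lt_of_lt_of_le (by positivity) hcard
  obtain ⟨x, hx, hpin⟩ := exists_pin_card_le hr hrs hsq (hsep.mono fun x hx => (hmem hx).1)
    (p₀ := p) (fun x hx => (mem_ball.1 (hmem hx).2).le) hP_ne
  refine ⟨x, hmem hx, ?_⟩
  rw [← hP, ← Finset.coe_image, ncard_coe_finset]
  refine hs _ ?_
  calc (1 / (2 * R)) ^ n * q ^ n = (q / 2 / R) ^ n := by rw [← mul_pow]; ring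
    _ ≤ (P.image (dist · x)).card * (6 * n * (8 * q / s) ^ (n - 1)) +
        (3 * s / r) ^ n * (5 * q / r) ^ (n - 1) := hcard.trans hpin
    _ = (P.image (dist · x)).card * (6 * n * 8 ^ (n - 1) * (q / s) ^ (n - 1)) +
        (3 / r) ^ n * (5 / r) ^ (n - 1) * (s ^ n * q ^ (n - 1)) := by
        simp only [div_pow, mul_pow]
        ring

end DeloneSet

theorem corollary1p2_general (E : Type*) [NormedAddCommGroup E] [InnerProductSpace ℝ E]
    [FiniteDimensional ℝ E] [Nontrivial E] {r R : ℝ} (hr : 0 < r) (hR : 0 < R) :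
    ∃ κ > 0, ∀ A : DeloneSet E, r ≤ A.packingRadius → A.coveringRadius ≤ R → ∀ (p : E) (q : ℝ),
      ((A : Set E) ∩ ball p q).Finite ∧ (((A : Set E) ∩ ball p q).Nonempty →
        ∃ x ∈ (A : Set E) ∩ ball p q,
        κ * ((↑A ∩ ball p q).ncard : ℝ) ^ (2 / finrank ℝ E - 1 / finrank ℝ E ^ 2 : ℝ) ≤
          ((dist · x) '' (A ∩ ball p q)).ncard) := by
  obtain ⟨κ, hκ, hlarge⟩ := exists_mul_rpow_le_pinned_distances E hr hR
  obtain ⟨q₀, hq₀⟩ := eventually_atTop.1 (hlarge.and (eventually_ge_atTop r))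
  have hr₀ : r ≤ q₀ := (hq₀ q₀ le_rfl).2
  set e : ℝ := 2 - 1 / finrank ℝ E
  have hq₀_pos : 0 < q₀ := hr.trans_le hr₀
  -- The first constant serves radii `q ≥ q₀`; below `q₀` the second makes the bound at most `1`.
  refine ⟨min (κ * (r / 3) ^ e) ((3 * q₀ / r) ^ e)⁻¹, by positivity,
    fun A hAr hAR p q => ?_⟩
  have hfin := finite_inter_of_pairwise_le_dist hr (pairwise_le_dist_of_le_packingRadius hAr)
    (isBounded_ball (x := p) (r := q))
  refine ⟨hfin, fun hne => ?_⟩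
  rcases le_total q₀ q with hq | hq
  · obtain ⟨x, hx, hpin⟩ := (hq₀ q hq).1 A hAr hAR p
    have hq_pos : 0 < q := hq₀_pos.trans_le hq
    refine ⟨x, hx, le_trans ?_ hpin⟩
    calc _ ≤ κ * (r / 3) ^ e * (3 * q / r) ^ e := by
          gcongr
          · exact min_le_left _ _
          · exact ncard_rpow_le_of_le_packingRadius hr hAr le_rfl (hr₀.trans hq)
      _ = κ * q ^ e := by
          rw [mul_assoc, ← Real.mul_rpow (by positivity) (by positivity)]
          congr 2
          field_simp
  · obtain ⟨x, hx⟩ := hne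
    refine ⟨x, hx, ?_⟩
    calc _ ≤ ((3 * q₀ / r) ^ e)⁻¹ * (3 * q₀ / r) ^ e := by
          gcongr
          · exact min_le_right _ _
          · exact ncard_rpow_le_of_le_packingRadius hr hAr hq hr₀
      _ = 1 := inv_mul_cancel₀ (by positivity)
      _ ≤ ((dist · x) '' (A ∩ ball p q)).ncard := by
          exact_mod_cast (ncard_pos (hfin.image _)).2 ⟨_, mem_image_of_mem _ hx⟩

namespace IsWellDistributed

variable {d : ℕ} {c C : ℝ} {A : Set (EuclideanSpace ℝ (Fin d))}

theorem exists_dist_le (hA : IsWellDistributed c C A) (hC : 0 ≤ C)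
    (y : EuclideanSpace ℝ (Fin d)) : ∃ a ∈ A, dist y a ≤ √d * C := by
  obtain ⟨a, ha, hya⟩ := hA.meets_cubes y
  refine ⟨a, ha, ?_⟩
  rw [EuclideanSpace.dist_eq]
  calc √(∑ i, dist (y i) (a i) ^ 2) ≤ √(∑ _i : Fin d, C ^ 2) := by
        gcongr with i
        rw [Real.dist_eq, abs_le]
        constructor <;> linarith [hya i]
    _ = √d * C := by simp [Real.sqrt_sq hC]

/-- A well-distributed set as a Delone set. Mathlib asks for strict separation, so the packing
radius is `c / 2` rather than `c`. -/
noncomputable def toDeloneSet (hA : IsWellDistributed c C A) (hd : 1 ≤ d) (hc : 0 < c)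
    (hC : 0 < C) : DeloneSet (EuclideanSpace ℝ (Fin d)) where
  carrier := A
  packingRadius := (c / 2).toNNReal
  packingRadius_pos := Real.toNNReal_pos.2 (half_pos hc)
  isSeparated_packingRadius := fun a ha b hb hab => by
    change ENNReal.ofReal (c / 2) < edist a b
    rw [edist_dist, ENNReal.ofReal_lt_ofReal_iff (dist_pos.2 hab), dist_eq_norm]
    exact (half_lt_self hc).trans_le (hA.separated a ha b hb hab)
  coveringRadius := (√d * C).toNNReal
  coveringRadius_pos := Real.toNNReal_pos.2 (by positivity)
  isCover_coveringRadius := fun y _ => by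
    obtain ⟨a, ha, hya⟩ := hA.exists_dist_le hC.le y
    exact ⟨a, ha, (edist_dist y a).trans_le (ENNReal.ofReal_le_ofReal hya)⟩

end IsWellDistributed

theorem mul_rpow_ncard_le_ncard_distanceSet {d : ℕ} {S : Set (EuclideanSpace ℝ (Fin d))}
    (hS : S.Finite) {κ e : ℝ} (he : e ≠ 0)
    (hpin : S.Nonempty → ∃ x ∈ S, κ * (S.ncard : ℝ) ^ e ≤ ((dist · x) '' S).ncard) :
    κ * (S.ncard : ℝ) ^ e ≤ (distanceSet S).ncard := by
  rcases S.eq_empty_or_nonempty with rfl | hne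
  · simp [Real.zero_rpow he]
  obtain ⟨x, hx, hle⟩ := hpin hne
  have hfin : (distanceSet S).Finite :=
    (hS.image2 dist hS).subset fun _ ⟨x, hx, y, hy, h⟩ => ⟨x, hx, y, hy, by simp [h, dist_eq_norm]⟩
  have hsub : (dist · x) '' S ⊆ distanceSet S := by
    rintro _ ⟨y, hy, rfl⟩
    exact ⟨y, hy, x, hx, dist_eq_norm y x⟩
  exact hle.trans (by exact_mod_cast ncard_le_ncard hsub hfin)

theorem corollary1p2 (d : ℕ) (hd : 1 ≤ d) (c C : ℝ) (hc : 0 < c) (hC : 0 < C) :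
    ∃ κ : ℝ, 0 < κ ∧
      ∀ A : Set (EuclideanSpace ℝ (Fin d)), IsWellDistributed c C A →
        ∀ q : ℝ, 0 < q →
          (truncation A q).Finite ∧
          κ * ((truncation A q).ncard : ℝ) ^ ((2 : ℝ) / (d : ℝ) - 1 / (d : ℝ) ^ 2) ≤
            ((distanceSet (truncation A q)).ncard : ℝ) := by
  have : Nontrivial (EuclideanSpace ℝ (Fin d)) :=
    nontrivial_of_finrank_pos (R := ℝ) (by rwa [finrank_euclideanSpace_fin])
  obtain ⟨κ, hκ, h⟩ := corollary1p2_general (EuclideanSpace ℝ (Fin d)) (half_pos hc)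
    (R := √d * C) (by positivity)
  rw [finrank_euclideanSpace_fin] at h
  refine ⟨κ, hκ, fun A hA q _ => ?_⟩
  obtain ⟨hfin, hpin⟩ := h (hA.toDeloneSet hd hc hC) (Real.le_coe_toNNReal _)
    (Real.coe_toNNReal _ (by positivity)).le 0 q
  exact ⟨hfin, mul_rpow_ncard_le_ncard_distanceSet hfin (two_div_sub_one_div_sq_pos hd).ne' hpin⟩
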